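/- **Model.** For $n,d\in\mathbb N$, $\boldsymbol\mu\in\mathbb R^d$ and $\rho\in[0,1]$, let $\sigma\in\{-1,+1\}^n$ be a vector of community labels (with an arbitrary law, possibly deterministic), let $\boldsymbol z_1,\dots,\boldsymbol z_n,\boldsymbol w_1,\dots,\boldsymbol w_n$ be i.i.d. $\mathcal N(0,I_d)$ vectors and let $\pi_*$ be a uniformly random permutation of $[n]$, with $\sigma$, $(\boldsymbol z_i)$, $(\boldsymbol w_i)$, $\pi_*$ independent. Put $\boldsymbol x_i=\boldsymbol\mu\sigma_i+\boldsymbol z_i$, $\boldsymbol y'_i=\boldsymbol\mu\sigma_i+\rho\boldsymbol z_i+\sqrt{1-\rho^2}\,\boldsymbol w_i$ and $\boldsymbol y_j=\boldsymbol y'_{\pi_*^{-1}(j)}$. The pair $X=(\boldsymbol x_i)_{i\in[n]}$, $Y=(\boldsymbol y_i)_{i\in[n]}$ is the pair of correlated Gaussian mixture databases, written $(X,Y)\sim\mathrm{CGMMs}(n,\boldsymbol\mu,d,\rho)$. **Theorem 1 (achievability for exact matching).** Let $d$, $\boldsymbol\mu$, $\rho$ and the law of $\sigma$ depend on $n$ in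 an arbitrary way, and let $(X,Y)\sim\mathrm{CGMMs}(n,\boldsymbol\mu,d,\rho)$. Suppose that, as $n\to\infty$, either $$\frac d4\log\frac1{1-\rho^2}\ \ge\ \log n+\omega(1)\qquad\text{and}\qquad \|\boldsymbol\mu\|^2\ \ge\ 2\log n+\omega(1),$$ or, for some constant $\epsilon>0$ (which may be arbitrarily small), $$\frac d4\log\frac1{1-\rho^2}\ \ge\ (1+\epsilon)\log n\qquad\text{and}\qquad d=\omega(\log n).$$ Here $\log\frac10=\infty$ and $0\cdot\infty=0$, inequalities are required for all sufficiently large $n$, and $\omega(1)$ stands for a sequence that tends to $+\infty$. Then there is a (measurable) estimator $\hat\pi=\hat\pi(X,Y)$ with $\hat\pi(X,Y)=\pi_*$ with high probability, i.e. $\mathbb P\{\hat\pi(X,Y)=\pi_*\}\to1$ as $n\to\infty$. Such an estimator is the minimum total squared distance estimator $$\hat\pi(X,Y)\in\operatorname*{arg\,min}_{\pi\in S_n}\ \sum_{i=1}^n\|\boldsymbol x_i-\boldsymbol y_{\pi(i)}\|^2,$$ which recovers $\pi_*$ with high probability however ties are broken. -/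

import Mathlib

open MeasureTheory ProbabilityTheory Filter Topology Asymptotics

namespace CGMM

/-- A database with `n` rows in `ℝ^d`; row `i` is the attribute of node `i`. -/
abbrev Database (n d : ℕ) : Type := Fin n → EuclideanSpace ℝ (Fin d)

/-- A vector of community labels `σ ∈ {-1, +1}^n`. -/
abbrev Labels (n : ℕ) : Type := Fin n → ℤˣ

/-- The finite set of permutations carries the discrete σ-algebra. -/
instance instMeasurableSpacePerm (n : ℕ) : MeasurableSpace (Equiv.Perm (Fin n)) := ⊤

/-- The first database: `x_i = μ σ_i + z_i`. -/
noncomputable def rowsX {n d : ℕ} (μ : EuclideanSpace ℝ (Fin d)) (σ : Labels n)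
    (z : Database n d) : Database n d :=
  fun i => ((σ i : ℤ) : ℝ) • μ + z i

/-- The second database before its rows are permuted:
`y'_i = μ σ_i + ρ z_i + √(1 - ρ²) w_i`. -/
noncomputable def rowsY' {n d : ℕ} (μ : EuclideanSpace ℝ (Fin d)) (ρ : ℝ) (σ : Labels n)
    (z w : Database n d) : Database n d :=
  fun i => ((σ i : ℤ) : ℝ) • μ + ρ • z i + √(1 - ρ ^ 2) • w i

/-- The permuted database: row `j` of the result is row `π⁻¹(j)` of the argument. -/
def permuteRows {n d : ℕ} (π : Equiv.Perm (Fin n)) (y' : Database n d) : Database n d :=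
  fun j => y' (π.symm j)

/-- The joint law of `n` independent standard Gaussian vectors in `ℝ^d`. -/
noncomputable def gaussianRows (n d : ℕ) : Measure (Database n d) :=
  Measure.pi fun _ => stdGaussian (EuclideanSpace ℝ (Fin d))

/-- The joint law of the latent variables `(σ, π_*, z, w)`, which are independent: the label vector
`σ` has law `ν`, the permutation `π_*` is uniform, and `z`, `w` have i.i.d. standard Gaussian
rows. -/
noncomputable def latentLaw {n : ℕ} (d : ℕ) (ν : Measure (Labels n)) :
    Measure (Labels n × Equiv.Perm (Fin n) × Database n d × Database n d) :=
  ν.prod ((uniformOn (Set.univ : Set (Equiv.Perm (Fin n)))).prod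
    ((gaussianRows n d).prod (gaussianRows n d)))

/-- The joint law of `(π_*, X, Y)` in the correlated Gaussian mixture model with label law `ν`, mean
vector `μ` and correlation parameter `ρ`. -/
noncomputable def law {n d : ℕ} (ν : Measure (Labels n)) (μ : EuclideanSpace ℝ (Fin d)) (ρ : ℝ) :
    Measure (Equiv.Perm (Fin n) × Database n d × Database n d) :=
  (latentLaw d ν).map fun ω =>
    (ω.2.1, rowsX μ ω.1 ω.2.2.1, permuteRows ω.2.1 (rowsY' μ ρ ω.1 ω.2.2.1 ω.2.2.2))

/-- The map in the definition of `law` is measurable, so that `law` is a genuine push-forward. -/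
theorem measurable_sample {n d : ℕ} (μ : EuclideanSpace ℝ (Fin d)) (ρ : ℝ) :
    Measurable fun ω : Labels n × Equiv.Perm (Fin n) × Database n d × Database n d =>
      (ω.2.1, rowsX μ ω.1 ω.2.2.1, permuteRows ω.2.1 (rowsY' μ ρ ω.1 ω.2.2.1 ω.2.2.2)) := by
  have hs : ∀ i : Fin n,
      Measurable fun ω : Labels n × Equiv.Perm (Fin n) × Database n d × Database n d =>
        ((ω.1 i : ℤ) : ℝ) • μ := by
    intro i
    have h1 : Measurable fun u : ℤˣ => ((u : ℤ) : ℝ) • μ :=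
      (measurable_from_top (f := fun k : ℤ => (k : ℝ) • μ)).comp (comap_measurable Units.val)
    exact h1.comp ((measurable_pi_apply i).comp measurable_fst)
  have hy : Measurable fun ω : Labels n × Equiv.Perm (Fin n) × Database n d × Database n d =>
      rowsY' μ ρ ω.1 ω.2.2.1 ω.2.2.2 := by
    refine measurable_pi_lambda _ fun i => ?_
    exact ((hs i).add ((by fun_prop : Measurable fun ω : Labels n × Equiv.Perm (Fin n) ×
      Database n d × Database n d => ω.2.2.1 i).const_smul ρ)).add
      ((by fun_prop : Measurable fun ω : Labels n × Equiv.Perm (Fin n) ×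
      Database n d × Database n d => ω.2.2.2 i).const_smul (√(1 - ρ ^ 2)))
  refine (by fun_prop : Measurable _).prodMk (Measurable.prodMk ?_ ?_)
  · refine measurable_pi_lambda _ fun i => ?_
    exact (hs i).add (by fun_prop)
  · have h2 : Measurable fun p : Equiv.Perm (Fin n) × Database n d => permuteRows p.1 p.2 :=
      measurable_from_prod_countable_right fun π =>
        measurable_pi_lambda _ fun j => measurable_pi_apply (π.symm j)
    exact h2.comp ((by fun_prop : Measurable fun ω : Labels n × Equiv.Perm (Fin n) ×
      Database n d × Database n d => ω.2.1).prodMk hy)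

/-- The law of the model is a probability measure. -/
instance isProbabilityMeasure_law {n d : ℕ} (ν : Measure (Labels n)) [IsProbabilityMeasure ν]
    (μ : EuclideanSpace ℝ (Fin d)) (ρ : ℝ) : IsProbabilityMeasure (law ν μ ρ) := by
  have : IsProbabilityMeasure (uniformOn (Set.univ : Set (Equiv.Perm (Fin n)))) :=
    isProbabilityMeasure_uniformOn Set.finite_univ Set.univ_nonempty
  have : IsProbabilityMeasure (gaussianRows n d) := by
    unfold gaussianRows; infer_instance
  have : IsProbabilityMeasure (latentLaw d ν) := by
    unfold latentLaw; infer_instance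
  exact Measure.isProbabilityMeasure_map (measurable_sample μ ρ).aemeasurable

/-- An estimator of the latent permutation from the observed pair `(X, Y)`. -/
abbrev Estimator (n d : ℕ) : Type := Database n d × Database n d → Equiv.Perm (Fin n)

/-- The total squared distance `∑ i, ‖x_i - y_{π(i)}‖²`. -/
noncomputable def totalSqDist {n d : ℕ} (X Y : Database n d) (π : Equiv.Perm (Fin n)) : ℝ :=
  ∑ i, ‖X i - Y (π i)‖ ^ 2

/-- `πhat` always returns a permutation that minimizes the total squared distance; ties may be
broken in any way. -/
def IsMinDistEstimator {n d : ℕ} (πhat : Estimator n d) : Prop :=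
  ∀ (X Y : Database n d) (π : Equiv.Perm (Fin n)),
    totalSqDist X Y (πhat (X, Y)) ≤ totalSqDist X Y π

/-- The extended real number `(d / 4) log (1 / (1 - ρ²))` for `0 ≤ ρ ≤ 1`, where `log (1 / 0) = ∞`
and `0 * ∞ = 0`. -/
noncomputable def signal (d : ℕ) (ρ : ℝ) : EReal :=
  (((d : ℝ) / 4 : ℝ) : EReal) * ENNReal.log (ENNReal.ofReal (1 - ρ ^ 2))⁻¹

theorem signal_of_lt_one (d : ℕ) {ρ : ℝ} (h0 : 0 ≤ ρ) (h1 : ρ < 1) :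
    signal d ρ = (((d : ℝ) / 4 * Real.log (1 / (1 - ρ ^ 2)) : ℝ) : EReal) := by
  have h : 0 < 1 - ρ ^ 2 := by nlinarith
  rw [signal, ← ENNReal.ofReal_inv_of_pos h, ENNReal.log_ofReal_of_pos (inv_pos.2 h), one_div,
    EReal.coe_mul]

theorem signal_one {d : ℕ} (hd : d ≠ 0) : signal d 1 = ⊤ := by
  have h : (0 : ℝ) < (d : ℝ) / 4 := by positivity
  simp [signal, EReal.coe_mul_top_of_pos h]

end CGMM

/-! ### An inequality of Finner type for permutations -/

/-! Union bound over the wrong permutations, with a Chernoff bound that handles all cycle types at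
once. Relabelling makes the true permutation the identity. Then `π` does at least as well exactly
when `∑ ⟨x_{π⁻¹ i} - x_i, y'_i⟩ ≥ 0`. Exponentiate with parameter `t` and integrate out `w`. Up to
terms that cancel under summation along `π⁻¹` (`sum_inner_diff_eq`), the result is a product over
`i` of square roots of kernels in `(z_i, z_{π⁻¹ i})`.

Each `z_j` occurs in at most two of these factors, so Cauchy–Schwarz in each coordinate
(`lintegral_prod_sqrt_perm_le`) replaces the product by one of `L²` norms, without any cycle
decomposition. A two-point Gaussian integral (`lintegral_pair_kernel_le`) bounds each norm by `q =
(1 + 4a)^(-d/4)`, where `a = tρ - t²(1 - ρ²)`, whatever the means.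

Hence `π` wins with probability at most `q ^ |supp π|`. At most `n ^ k` permutations move exactly
`k` points, and `k ≥ 2`, so the total error is at most `2(nq)²` once `nq ≤ 1/2`. For `ρ < 1` the
best `t` gives `q = (1 - ρ²)^(d/4)`, so `nq → 0` when the signal exceeds `log n` by a diverging
amount. Both alternatives of the theorem provide this. -/

theorem lintegral_sqrt_mul_sqrt_le {α : Type*} [MeasurableSpace α] (m : Measure α)
    {f g : α → ENNReal} (hf : Measurable f) (hg : Measurable g) :
    ∫⁻ a, f a ^ (1 / 2 : ℝ) * g a ^ (1 / 2 : ℝ) ∂m ≤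
      (∫⁻ a, f a ∂m) ^ (1 / 2 : ℝ) * (∫⁻ a, g a ∂m) ^ (1 / 2 : ℝ) := by
  have h := ENNReal.lintegral_mul_le_Lp_mul_Lq m (p := 2) (q := 2)
    (f := fun a => f a ^ (1 / 2 : ℝ)) (g := fun a => g a ^ (1 / 2 : ℝ))
    (Real.HolderConjugate.two_two) (hf.pow_const _).aemeasurable (hg.pow_const _).aemeasurable
  have e : ∀ y : ENNReal, (y ^ (1 / 2 : ℝ)) ^ (2 : ℝ) = y := fun y => by
    rw [← ENNReal.rpow_mul]
    norm_num
  simpa only [Pi.mul_apply, e] using h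

theorem lintegral_sqrt_le {α : Type*} [MeasurableSpace α] (m : Measure α) [IsProbabilityMeasure m]
    {f : α → ENNReal} (hf : Measurable f) :
    ∫⁻ a, f a ^ (1 / 2 : ℝ) ∂m ≤ (∫⁻ a, f a ∂m) ^ (1 / 2 : ℝ) := by
  simpa using lintegral_sqrt_mul_sqrt_le m hf (measurable_const (a := (1 : ENNReal)))

/-- Cauchy–Schwarz for two distinct indices. If they coincide, the set is a singleton and Jensen for
the probability measure takes over; this is the case of a fixed point. -/
theorem lintegral_prod_pair_sqrt_le {α ι : Type*} [MeasurableSpace α] [DecidableEq ι]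
    (m : Measure α) [IsProbabilityMeasure m] {f : ι → α → ENNReal} (hf : ∀ i, Measurable (f i))
    (j k : ι) :
    ∫⁻ a, ∏ i ∈ {j, k}, f i a ^ (1 / 2 : ℝ) ∂m ≤
      ∏ i ∈ {j, k}, (∫⁻ a, f i a ∂m) ^ (1 / 2 : ℝ) := by
  by_cases h : j = k
  · subst h
    simpa using lintegral_sqrt_le m (hf j)
  · simp_rw [Finset.prod_pair h]
    exact lintegral_sqrt_mul_sqrt_le m (hf j) (hf k)

/-- Coordinates are integrated out one at a time. Only the factors with index `j` and `τ⁻¹ j` see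
coordinate `j`, and exponent `1/2` is what Cauchy–Schwarz needs for two factors; the others come out
of the integral as constants. -/
theorem lmarginal_prod_sqrt_le {ι X : Type*} [Fintype ι] [DecidableEq ι] [MeasurableSpace X]
    (m : Measure X) [IsProbabilityMeasure m] (τ : Equiv.Perm ι) {G : ι → (ι → X) → ENNReal}
    (hG : ∀ i, Measurable (G i))
    (hdep : ∀ i j, j ≠ i → j ≠ τ i → ∀ x y, G i (Function.update x j y) = G i x)
    (s : Finset ι) (x : ι → X) :
    lmarginal (fun _ => m) s (fun x => ∏ i, G i x ^ (1 / 2 : ℝ)) x ≤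
      ∏ i, lmarginal (fun _ => m) s (G i) x ^ (1 / 2 : ℝ) := by
  have hprod : Measurable fun x => ∏ i, G i x ^ (1 / 2 : ℝ) :=
    Finset.measurable_prod _ fun i _ => (hG i).pow_const _
  induction s using Finset.induction generalizing x with
  | empty => simp
  | insert j s hj ih =>
    rw [lmarginal_insert _ hprod hj]
    set S : Finset ι := {j, τ.symm j} with hS
    have hconst : ∀ i ∈ Sᶜ, ∀ y, lmarginal (fun _ => m) s (G i) (Function.update x j y) =
        lmarginal (fun _ => m) s (G i) x := by
      intro i hi y
      simp only [hS, Finset.mem_compl, Finset.mem_insert, Finset.mem_singleton, not_or] at hi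
      rw [lmarginal_update_of_notMem (hG i) hj]
      congr 1
      funext z
      exact hdep i j (Ne.symm hi.1) (fun h => hi.2 (by rw [h, τ.symm_apply_apply])) z y
    have hmeas : ∀ i, Measurable fun y =>
        lmarginal (fun _ => m) s (G i) (Function.update x j y) := fun i =>
      ((hG i).lmarginal _).comp (measurable_update x)
    calc ∫⁻ y, lmarginal (fun _ => m) s (fun x => ∏ i, G i x ^ (1 / 2 : ℝ))
          (Function.update x j y) ∂m
        ≤ ∫⁻ y, ∏ i, lmarginal (fun _ => m) s (G i) (Function.update x j y) ^ (1 / 2 : ℝ) ∂m :=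
          lintegral_mono fun y => ih _
      _ = ∫⁻ y, (∏ i ∈ S, lmarginal (fun _ => m) s (G i) (Function.update x j y) ^ (1 / 2 : ℝ)) *
            ∏ i ∈ Sᶜ, lmarginal (fun _ => m) s (G i) x ^ (1 / 2 : ℝ) ∂m := by
          refine lintegral_congr fun y => ?_
          rw [← Finset.prod_mul_prod_compl S]
          congr 1
          exact Finset.prod_congr rfl fun i hi => by rw [hconst i hi]
      _ = (∫⁻ y, ∏ i ∈ S, lmarginal (fun _ => m) s (G i) (Function.update x j y) ^ (1 / 2 : ℝ) ∂m) *
            ∏ i ∈ Sᶜ, lmarginal (fun _ => m) s (G i) x ^ (1 / 2 : ℝ) :=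
          lintegral_mul_const _ (Finset.measurable_prod _ fun i _ => (hmeas i).pow_const _)
      _ ≤ (∏ i ∈ S, (∫⁻ y, lmarginal (fun _ => m) s (G i) (Function.update x j y) ∂m)
              ^ (1 / 2 : ℝ)) *
            ∏ i ∈ Sᶜ, lmarginal (fun _ => m) s (G i) x ^ (1 / 2 : ℝ) := by
          gcongr
          exact lintegral_prod_pair_sqrt_le m hmeas j (τ.symm j)
      _ = ∏ i, lmarginal (fun _ => m) (insert j s) (G i) x ^ (1 / 2 : ℝ) := by
          rw [← Finset.prod_mul_prod_compl S (fun i =>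
            lmarginal (fun _ => m) (insert j s) (G i) x ^ (1 / 2 : ℝ))]
          congr 1
          · exact Finset.prod_congr rfl fun i _ => by rw [lmarginal_insert _ (hG i) hj]
          · refine Finset.prod_congr rfl fun i hi => ?_
            rw [lmarginal_insert _ (hG i) hj, lintegral_congr (hconst i hi)]
            simp

theorem map_eval_pair_pi {ι X : Type*} [Fintype ι] [MeasurableSpace X] (m : Measure X)
    [IsProbabilityMeasure m] {i j : ι} (h : i ≠ j) :
    (Measure.pi fun _ : ι => m).map (fun x => (x i, x j)) = m.prod m := by
  have hi : IndepFun (fun x : ι → X => x i) (fun x => x j) (Measure.pi fun _ : ι => m) :=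
    (iIndepFun_pi (μ := fun _ : ι => m) (X := fun _ => id) fun _ => aemeasurable_id).indepFun h
  rw [(indepFun_iff_map_prod_eq_prod_map_map (measurable_pi_apply i).aemeasurable
    (measurable_pi_apply j).aemeasurable).1 hi]
  congr 1 <;> exact (measurePreserving_eval (fun _ : ι => m) _).map_eq

/-- If every variable occurs in at most two of the factors, then the integral of a product is at
most the product of the `L²` norms. Here the `i`-th factor depends on `x i` and `x (τ i)`. -/
theorem lintegral_prod_sqrt_perm_le {ι X : Type*} [Fintype ι] [DecidableEq ι] [MeasurableSpace X]
    (m : Measure X) [IsProbabilityMeasure m] (τ : Equiv.Perm ι) {g : ι → X × X → ENNReal}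
    (hg : ∀ i, Measurable (g i)) (hfix : ∀ i, τ i = i → ∀ y, g i (y, y) = 1) :
    ∫⁻ x, ∏ i, g i (x i, x (τ i)) ^ (1 / 2 : ℝ) ∂(Measure.pi fun _ : ι => m) ≤
      ∏ i ∈ τ.support, (∫⁻ p, g i p ∂(m.prod m)) ^ (1 / 2 : ℝ) := by
  have hG : ∀ i, Measurable fun x : ι → X => g i (x i, x (τ i)) := fun i =>
    (hg i).comp ((measurable_pi_apply i).prodMk (measurable_pi_apply (τ i)))
  rcases isEmpty_or_nonempty (ι → X) with h | ⟨⟨x⟩⟩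
  · simp [lintegral_of_isEmpty]
  rw [lintegral_eq_lmarginal_univ x]
  refine (lmarginal_prod_sqrt_le m τ hG ?_ Finset.univ x).trans_eq ?_
  · intro i j h1 h2 x y
    simp [Function.update_of_ne h1.symm, Function.update_of_ne h2.symm]
  -- Off the support the factor is identically 1; on it `i ≠ τ i`, so `(x i, x (τ i))` has law
  -- `m.prod m`.
  · rw [← Finset.prod_subset (Finset.subset_univ τ.support)]
    · refine Finset.prod_congr rfl fun i hi => ?_
      rw [lmarginal_univ, ← map_eval_pair_pi m (Equiv.Perm.mem_support.1 hi).symm,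
        lintegral_map (hg i) ((measurable_pi_apply i).prodMk (measurable_pi_apply (τ i)))]
    · intro i _ hi
      rw [Equiv.Perm.notMem_support] at hi
      simp [hi, hfix i hi]

/-! ### Gaussian integrals -/

theorem lintegral_prod_pi {ι : Type*} [Fintype ι] {X : ι → Type*} [∀ i, MeasurableSpace (X i)]
    (m : ∀ i, Measure (X i)) [∀ i, IsProbabilityMeasure (m i)] {f : ∀ i, X i → ENNReal}
    (hf : ∀ i, Measurable (f i)) :
    ∫⁻ x, ∏ i, f i (x i) ∂(Measure.pi m) = ∏ i, ∫⁻ y, f i y ∂(m i) := by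
  refine (lintegral_prod_eq_prod_lintegral_of_indepFun Finset.univ
    (fun i (x : ∀ i, X i) => f i (x i))
    (iIndepFun_pi fun i => (hf i).aemeasurable)
    fun i => (hf i).comp (measurable_pi_apply i)).trans ?_
  refine Finset.prod_congr rfl fun i _ => ?_
  rw [← (measurePreserving_eval m i).lintegral_comp (hf i)]

/-- Completing the square: the tilted density is a multiple of the Gaussian density with variance `1
/ (1 + 2a)`. -/
theorem gaussianPDFReal_mul_exp_quadratic {a : ℝ} (ha : 0 ≤ a) (b x : ℝ) :
    gaussianPDFReal 0 1 x * Real.exp (-a * x ^ 2 + b * x) =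
      (√(1 + 2 * a)⁻¹ * Real.exp (b ^ 2 / (2 * (1 + 2 * a)))) *
        gaussianPDFReal (b / (1 + 2 * a)) (Real.toNNReal (1 + 2 * a)⁻¹) x := by
  have h : 0 < 1 + 2 * a := by positivity
  rw [gaussianPDFReal, gaussianPDFReal, Real.coe_toNNReal _ (inv_pos.2 h).le,
    Real.sqrt_mul (by positivity) (1 + 2 * a)⁻¹]
  have h1 : √(1 + 2 * a)⁻¹ ≠ 0 := (Real.sqrt_pos.2 (inv_pos.2 h)).ne'
  have h2 : √(2 * Real.pi) ≠ 0 := (Real.sqrt_pos.2 (by positivity)).ne'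
  simp only [NNReal.coe_one, mul_one, mul_inv]
  rw [mul_assoc, ← Real.exp_add]
  have h3 : √(1 + 2 * a)⁻¹ * Real.exp (b ^ 2 / (2 * (1 + 2 * a))) *
      ((√(2 * Real.pi))⁻¹ * (√(1 + 2 * a)⁻¹)⁻¹ *
        Real.exp (-(x - b / (1 + 2 * a)) ^ 2 / (2 * (1 + 2 * a)⁻¹))) =
      (√(2 * Real.pi))⁻¹ * (Real.exp (b ^ 2 / (2 * (1 + 2 * a))) *
        Real.exp (-(x - b / (1 + 2 * a)) ^ 2 / (2 * (1 + 2 * a)⁻¹))) := by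
    field_simp
  rw [h3, ← Real.exp_add]
  congr 2
  field_simp
  ring

theorem lintegral_gaussianReal_exp_quadratic {a : ℝ} (ha : 0 ≤ a) (b : ℝ) :
    ∫⁻ x, ENNReal.ofReal (Real.exp (-a * x ^ 2 + b * x)) ∂(gaussianReal 0 1) =
      ENNReal.ofReal (√(1 + 2 * a)⁻¹ * Real.exp (b ^ 2 / (2 * (1 + 2 * a)))) := by
  have h : 0 < 1 + 2 * a := by positivity
  rw [gaussianReal_of_var_ne_zero _ one_ne_zero,
    lintegral_withDensity_eq_lintegral_mul _ (measurable_gaussianPDF 0 1) (by fun_prop)]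
  have h1 : ∀ x, (gaussianPDF 0 1 * fun x => ENNReal.ofReal (Real.exp (-a * x ^ 2 + b * x))) x =
      ENNReal.ofReal (√(1 + 2 * a)⁻¹ * Real.exp (b ^ 2 / (2 * (1 + 2 * a)))) *
        gaussianPDF (b / (1 + 2 * a)) (Real.toNNReal (1 + 2 * a)⁻¹) x := by
    intro x
    rw [Pi.mul_apply, gaussianPDF, gaussianPDF, ← ENNReal.ofReal_mul (gaussianPDFReal_nonneg _ _ _),
      gaussianPDFReal_mul_exp_quadratic ha, ENNReal.ofReal_mul (by positivity)]
  rw [lintegral_congr h1, lintegral_const_mul _ (measurable_gaussianPDF _ _),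
    lintegral_gaussianPDF_eq_one _ (by simpa using h), mul_one]

theorem lintegral_stdGaussian_exp_quadratic {d : ℕ} {a : ℝ} (ha : 0 ≤ a)
    (b : EuclideanSpace ℝ (Fin d)) :
    ∫⁻ z, ENNReal.ofReal (Real.exp (-a * ‖z‖ ^ 2 + inner ℝ b z))
        ∂(stdGaussian (EuclideanSpace ℝ (Fin d))) =
      ENNReal.ofReal (√(1 + 2 * a)⁻¹ ^ d * Real.exp (‖b‖ ^ 2 / (2 * (1 + 2 * a)))) := by
  rw [← map_pi_eq_stdGaussian, lintegral_map (by fun_prop) (by fun_prop)]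
  have h1 : ∀ x : Fin d → ℝ, ENNReal.ofReal (Real.exp (-a * ‖WithLp.toLp 2 x‖ ^ 2 +
      inner ℝ b (WithLp.toLp 2 x))) =
      ∏ i, ENNReal.ofReal (Real.exp (-a * x i ^ 2 + b i * x i)) := by
    intro x
    rw [← ENNReal.ofReal_prod_of_nonneg fun i _ => (Real.exp_pos _).le, ← Real.exp_sum,
      EuclideanSpace.norm_sq_eq, PiLp.inner_apply, Finset.sum_add_distrib, Finset.mul_sum]
    simp [mul_comm]
  rw [lintegral_congr h1, lintegral_prod_pi (fun _ => gaussianReal 0 1)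
    (f := fun i y => ENNReal.ofReal (Real.exp (-a * y ^ 2 + b i * y))) fun i => by fun_prop]
  simp_rw [lintegral_gaussianReal_exp_quadratic ha]
  rw [← ENNReal.ofReal_prod_of_nonneg fun i _ => by positivity, Finset.prod_mul_distrib,
    ← Real.exp_sum, EuclideanSpace.norm_sq_eq, Finset.sum_div]
  simp

/-- The squared `L²` norm of the kernel attached to a pair of nodes whose means differ by `v`. -/
theorem lintegral_pair_kernel_le {d : ℕ} {a g : ℝ} (ha : 0 ≤ a) (hg : 0 ≤ g) (hg' : g ≤ 1 / 2)
    (v : EuclideanSpace ℝ (Fin d)) :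
    ∫⁻ p, ENNReal.ofReal (Real.exp (-a * ‖v + p.1 - p.2‖ ^ 2 + 2 * g * inner ℝ v p.2 -
        g * ‖v‖ ^ 2))
        ∂((stdGaussian (EuclideanSpace ℝ (Fin d))).prod
          (stdGaussian (EuclideanSpace ℝ (Fin d)))) ≤
      ENNReal.ofReal (√(1 + 4 * a)⁻¹ ^ d) := by
  have h2 : 0 < 1 + 2 * a := by positivity
  have h4 : 0 < 1 + 4 * a := by positivity
  -- The coefficient of the quadratic form that remains after the first of the two vectors is
  -- integrated out.
  set c : ℝ := a / (1 + 2 * a) with hc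
  have hc0 : 0 ≤ c := by positivity
  rw [lintegral_prod_symm' _ (by fun_prop)]
  have e1 : ∀ z z' : EuclideanSpace ℝ (Fin d),
      ENNReal.ofReal (Real.exp (-a * ‖v + z - z'‖ ^ 2 + 2 * g * inner ℝ v z' - g * ‖v‖ ^ 2)) =
      ENNReal.ofReal (Real.exp (-a * ‖v - z'‖ ^ 2 + 2 * g * inner ℝ v z' - g * ‖v‖ ^ 2)) *
      ENNReal.ofReal (Real.exp (-a * ‖z‖ ^ 2 + inner ℝ ((-2 * a) • (v - z')) z)) := by
    intro z z'
    rw [← ENNReal.ofReal_mul (Real.exp_pos _).le, ← Real.exp_add]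
    congr 2
    rw [show v + z - z' = v - z' + z by abel, norm_add_sq_real, real_inner_smul_left]
    ring
  simp_rw [e1]
  have e2 : ∀ z' : EuclideanSpace ℝ (Fin d),
      ∫⁻ z, ENNReal.ofReal (Real.exp (-a * ‖v - z'‖ ^ 2 + 2 * g * inner ℝ v z' - g * ‖v‖ ^ 2)) *
        ENNReal.ofReal (Real.exp (-a * ‖z‖ ^ 2 + inner ℝ ((-2 * a) • (v - z')) z))
        ∂(stdGaussian (EuclideanSpace ℝ (Fin d))) =
      ENNReal.ofReal (√(1 + 2 * a)⁻¹ ^ d * Real.exp (-(c + g) * ‖v‖ ^ 2)) *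
      ENNReal.ofReal (Real.exp (-c * ‖z'‖ ^ 2 + inner ℝ ((2 * (c + g)) • v) z')) := by
    intro z'
    rw [lintegral_const_mul _ (by fun_prop), lintegral_stdGaussian_exp_quadratic ha,
      ← ENNReal.ofReal_mul (Real.exp_pos _).le, ← ENNReal.ofReal_mul (by positivity),
      mul_left_comm, mul_assoc (_ ^ d) (Real.exp _), ← Real.exp_add, ← Real.exp_add]
    congr 3
    rw [norm_smul, mul_pow, Real.norm_eq_abs, sq_abs, norm_sub_sq_real, real_inner_smul_left, hc]
    field_simp
    ring
  simp_rw [e2]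
  rw [lintegral_const_mul _ (by fun_prop), lintegral_stdGaussian_exp_quadratic hc0,
    ← ENNReal.ofReal_mul (by positivity)]
  apply ENNReal.ofReal_le_ofReal
  -- This is `(1 + 2a)(1 + 2c) = 1 + 4a`.
  have e3 : √(1 + 2 * a)⁻¹ ^ d * √(1 + 2 * c)⁻¹ ^ d = √(1 + 4 * a)⁻¹ ^ d := by
    rw [← mul_pow, ← Real.sqrt_mul (by positivity), hc]
    congr 2
    field_simp
    ring
  -- The only place where the means enter; `g ≤ 1/2` makes their contribution nonpositive, so `v`
  -- can be dropped.
  have e4 : -(c + g) * ‖v‖ ^ 2 + ‖(2 * (c + g)) • v‖ ^ 2 / (2 * (1 + 2 * c)) ≤ 0 := by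
    rw [norm_smul, mul_pow, Real.norm_eq_abs, sq_abs]
    have : -(c + g) * ‖v‖ ^ 2 + (2 * (c + g)) ^ 2 * ‖v‖ ^ 2 / (2 * (1 + 2 * c)) =
        -((c + g) * (1 - 2 * g) / (1 + 2 * c) * ‖v‖ ^ 2) := by
      field_simp
      ring
    rw [this, neg_nonpos]
    have : 0 ≤ 1 - 2 * g := by linarith
    positivity
  calc √(1 + 2 * a)⁻¹ ^ d * Real.exp (-(c + g) * ‖v‖ ^ 2) *
        (√(1 + 2 * c)⁻¹ ^ d * Real.exp (‖(2 * (c + g)) • v‖ ^ 2 / (2 * (1 + 2 * c))))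
      = (√(1 + 2 * a)⁻¹ ^ d * √(1 + 2 * c)⁻¹ ^ d) *
        Real.exp (-(c + g) * ‖v‖ ^ 2 + ‖(2 * (c + g)) • v‖ ^ 2 / (2 * (1 + 2 * c))) := by
        rw [Real.exp_add]; ring
    _ ≤ √(1 + 4 * a)⁻¹ ^ d * 1 := by
        rw [e3]
        gcongr
        exact Real.exp_le_one_iff.2 e4
    _ = _ := mul_one _

/-! ### Counting permutations by the size of their support -/

theorem card_perm_support_eq_le {α : Type*} [Fintype α] [DecidableEq α] (A : Finset α) :
    (Finset.univ.filter fun π : Equiv.Perm α => π.support = A).card ≤ A.card.factorial := by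
  calc (Finset.univ.filter fun π : Equiv.Perm α => π.support = A).card
      ≤ (Finset.univ.filter fun π : Equiv.Perm α => ∀ a, ¬ a ∈ A → π a = a).card := by
        refine Finset.card_le_card fun π hπ => ?_
        simp only [Finset.mem_filter, Finset.mem_univ, true_and] at hπ ⊢
        intro a ha
        rwa [← hπ, Equiv.Perm.notMem_support] at ha
    _ = Fintype.card {π : Equiv.Perm α // ∀ a, ¬ a ∈ A → π a = a} :=
        (Fintype.card_subtype _).symm
    _ = Fintype.card (Equiv.Perm {a // a ∈ A}) :=
        (Fintype.card_congr (Equiv.Perm.subtypeEquivSubtypePerm fun a => a ∈ A)).symm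
    _ = A.card.factorial := by rw [Fintype.card_perm, Fintype.card_coe]

/-- Choosing the support and then a permutation of it gives at most `C(n, k) k! = n(n-1)⋯(n-k+1)`
possibilities. -/
theorem card_perm_card_support_eq_le {α : Type*} [Fintype α] [DecidableEq α] (k : ℕ) :
    (Finset.univ.filter fun π : Equiv.Perm α => π.support.card = k).card ≤
      Fintype.card α ^ k := by
  have h : (Finset.univ.filter fun π : Equiv.Perm α => π.support.card = k) ⊆
      (Finset.powersetCard k (Finset.univ : Finset α)).biUnion fun A =>
        Finset.univ.filter fun π : Equiv.Perm α => π.support = A := by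
    intro π hπ
    simpa using hπ
  calc _ ≤ _ := Finset.card_le_card h
    _ ≤ (Finset.powersetCard k (Finset.univ : Finset α)).card * k.factorial := by
        refine Finset.card_biUnion_le_card_mul _ _ _ fun A hA => ?_
        rw [← (Finset.mem_powersetCard.1 hA).2]
        exact card_perm_support_eq_le A
    _ = (Fintype.card α).descFactorial k := by
        rw [Finset.card_powersetCard, Finset.card_univ, mul_comm,
          ← Nat.descFactorial_eq_factorial_mul_choose]
    _ ≤ Fintype.card α ^ k := Nat.descFactorial_le_pow _ _

theorem sum_perm_pow_card_support_le {n : ℕ} {q : ℝ} (hq : 0 ≤ q) (h : n * q ≤ 1 / 2) :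
    ∑ π ∈ Finset.univ.erase (1 : Equiv.Perm (Fin n)), q ^ π.support.card ≤ 2 * (n * q) ^ 2 := by
  have hmaps : ∀ π ∈ Finset.univ.erase (1 : Equiv.Perm (Fin n)),
      π.support.card ∈ Finset.Ico 2 (n + 2) := by
    intro π hπ
    have h1 := Equiv.Perm.two_le_card_support_of_ne_one (Finset.ne_of_mem_erase hπ)
    have h2 : π.support.card ≤ n := by simpa using Finset.card_le_univ π.support
    exact Finset.mem_Ico.2 ⟨h1, by omega⟩
  have hnq : 0 ≤ n * q := by positivity
  rw [← Finset.sum_fiberwise_of_maps_to hmaps]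
  calc _ ≤ ∑ k ∈ Finset.Ico 2 (n + 2), (n * q) ^ k := by
        refine Finset.sum_le_sum fun k _ => ?_
        rw [Finset.sum_congr rfl (g := fun _ => q ^ k) (by simp +contextual), Finset.sum_const,
          nsmul_eq_mul, mul_pow]
        refine mul_le_mul_of_nonneg_right ?_ (by positivity)
        have h1 : ((Finset.univ.erase (1 : Equiv.Perm (Fin n))).filter
            fun π => π.support.card = k).card ≤ n ^ k :=
          (Finset.card_le_card (Finset.filter_subset_filter _ (Finset.erase_subset _ _))).trans
            (by simpa using card_perm_card_support_eq_le (α := Fin n) k)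
        exact_mod_cast h1
    _ ≤ (n * q) ^ 2 / (1 - n * q) := geom_sum_Ico_le_of_lt_one hnq (by linarith)
    _ ≤ 2 * (n * q) ^ 2 := by
        rw [div_le_iff₀ (by linarith)]
        nlinarith [sq_nonneg (n * q)]

/-! ### The Chernoff bound for a fixed permutation -/

/-- The left side is the exponent once `w` is integrated out. Writing `h + ρz = ρ(h + z) + (1 - ρ)h`
and polarizing turns each summand into a function of differences, up to a term `F (τ i) - F i` whose
sum vanishes. The factor `1/2` produces the square roots of the kernels. -/
theorem sum_inner_diff_eq {ι E : Type*} [Fintype ι] [NormedAddCommGroup E] [InnerProductSpace ℝ E]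
    (τ : Equiv.Perm ι) (h z : ι → E) (t ρ s : ℝ) :
    (t * ∑ i, inner ℝ (h (τ i) + z (τ i) - (h i + z i)) (h i + ρ • z i)) +
      ∑ i, ‖(t * s) • (h (τ i) + z (τ i) - (h i + z i))‖ ^ 2 / 2 =
    ∑ i, 1 / 2 * (-(t * ρ - t ^ 2 * s ^ 2) * ‖h i - h (τ i) + z i - z (τ i)‖ ^ 2 +
      2 * (t * (1 - ρ)) * inner ℝ (h i - h (τ i)) (z (τ i)) -
      t * (1 - ρ) * ‖h i - h (τ i)‖ ^ 2) := by
  have hτ : ∑ i, (t * ρ / 2 * ‖h (τ i) + z (τ i)‖ ^ 2 +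
        t * (1 - ρ) * (1 / 2 * ‖h (τ i)‖ ^ 2 + inner ℝ (h (τ i)) (z (τ i)))) =
      ∑ i, (t * ρ / 2 * ‖h i + z i‖ ^ 2 +
        t * (1 - ρ) * (1 / 2 * ‖h i‖ ^ 2 + inner ℝ (h i) (z i))) :=
    Equiv.sum_comp τ fun i => t * ρ / 2 * ‖h i + z i‖ ^ 2 +
        t * (1 - ρ) * (1 / 2 * ‖h i‖ ^ 2 + inner ℝ (h i) (z i))
  rw [← sub_eq_zero] at hτ
  rw [← sub_eq_zero, ← hτ, Finset.mul_sum, ← Finset.sum_add_distrib, ← Finset.sum_sub_distrib,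
    ← Finset.sum_sub_distrib]
  refine Finset.sum_congr rfl fun i _ => ?_
  generalize h i = a
  generalize h (τ i) = b
  generalize z i = x
  generalize z (τ i) = y
  simp only [← real_inner_self_eq_norm_sq, inner_add_left, inner_add_right, inner_sub_left,
    inner_sub_right, real_inner_smul_left, real_inner_smul_right]
  rw [real_inner_comm b a, real_inner_comm x a, real_inner_comm y a, real_inner_comm x b,
    real_inner_comm y b, real_inner_comm x y]
  ring

namespace CGMM

/-- The permutation is moved onto `X`, so that the noise `w i` in row `i` of `Y` meets only one
factor. -/
theorem totalSqDist_eq {n d : ℕ} (X Y : Database n d) (π : Equiv.Perm (Fin n)) :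
    totalSqDist X Y π =
      ∑ i, ‖X i‖ ^ 2 + ∑ i, ‖Y i‖ ^ 2 - 2 * ∑ i, inner ℝ (X (π⁻¹ i)) (Y i) := by
  have h1 : ∑ i, ‖Y i‖ ^ 2 = ∑ i, ‖Y (π i)‖ ^ 2 := (Equiv.sum_comp π fun i => ‖Y i‖ ^ 2).symm
  have h2 : ∑ i, inner ℝ (X (π⁻¹ i)) (Y i) = ∑ i, inner ℝ (X i) (Y (π i)) := by
    rw [← Equiv.sum_comp π]
    simp
  rw [h1, h2, totalSqDist, Finset.mul_sum, ← Finset.sum_add_distrib, ← Finset.sum_sub_distrib]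
  refine Finset.sum_congr rfl fun i _ => ?_
  rw [norm_sub_sq_real]
  ring

theorem measurable_totalSqDist {n d : ℕ} (π : Equiv.Perm (Fin n)) :
    Measurable fun p : Database n d × Database n d => totalSqDist p.1 p.2 π := by
  unfold totalSqDist
  fun_prop

instance isProbabilityMeasure_gaussianRows (n d : ℕ) : IsProbabilityMeasure (gaussianRows n d) := by
  unfold gaussianRows
  infer_instance

/-- The pointwise inequality behind exponential Markov, with the part free of `w` split from a
product over the rows of `w`. -/
theorem one_le_exp_of_totalSqDist_le {n d : ℕ} {t : ℝ} (ht : 0 ≤ t) (μ : EuclideanSpace ℝ (Fin d))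
    (ρ : ℝ) (σ : Labels n) (z w : Database n d) (π : Equiv.Perm (Fin n))
    (h : totalSqDist (rowsX μ σ z) (rowsY' μ ρ σ z w) π ≤
      totalSqDist (rowsX μ σ z) (rowsY' μ ρ σ z w) 1) :
    1 ≤ Real.exp (t * ∑ i, inner ℝ (rowsX μ σ z (π⁻¹ i) - rowsX μ σ z i)
        (((σ i : ℤ) : ℝ) • μ + ρ • z i)) *
      ∏ i, Real.exp (inner ℝ
        ((t * √(1 - ρ ^ 2)) • (rowsX μ σ z (π⁻¹ i) - rowsX μ σ z i)) (w i)) := by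
  rw [← Real.exp_sum, ← Real.exp_add, Real.one_le_exp_iff]
  have h1 : t * ∑ i, inner ℝ (rowsX μ σ z (π⁻¹ i) - rowsX μ σ z i)
        (((σ i : ℤ) : ℝ) • μ + ρ • z i) +
      ∑ i, inner ℝ ((t * √(1 - ρ ^ 2)) • (rowsX μ σ z (π⁻¹ i) - rowsX μ σ z i)) (w i) =
      t * (∑ i, inner ℝ (rowsX μ σ z (π⁻¹ i)) (rowsY' μ ρ σ z w i) -
        ∑ i, inner ℝ (rowsX μ σ z i) (rowsY' μ ρ σ z w i)) := by
    rw [← Finset.sum_sub_distrib, Finset.mul_sum, Finset.mul_sum, ← Finset.sum_add_distrib]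
    refine Finset.sum_congr rfl fun i _ => ?_
    rw [← inner_sub_left, rowsY', inner_add_right _ _ (√(1 - ρ ^ 2) • w i), real_inner_smul_left,
      real_inner_smul_right _ (w i)]
    ring
  rw [h1]
  rw [totalSqDist_eq, totalSqDist_eq] at h
  simp only [inv_one, Equiv.Perm.one_apply] at h
  exact mul_nonneg ht (by linarith)

/-- For every choice of labels, the probability that a permutation `π` beats the identity is at
most the `π.support.card`-th power of a number that does not depend on the means. -/
theorem measure_totalSqDist_le_one_le {n d : ℕ} {t ρ : ℝ} (ht : 0 ≤ t) (hρ : ρ ∈ Set.Icc (0 : ℝ) 1)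
    (ha : 0 ≤ t * ρ - t ^ 2 * (1 - ρ ^ 2)) (hg : t * (1 - ρ) ≤ 1 / 2)
    (μ : EuclideanSpace ℝ (Fin d)) (σ : Labels n) (π : Equiv.Perm (Fin n)) :
    (gaussianRows n d).prod (gaussianRows n d)
      {p | totalSqDist (rowsX μ σ p.1) (rowsY' μ ρ σ p.1 p.2) π ≤
        totalSqDist (rowsX μ σ p.1) (rowsY' μ ρ σ p.1 p.2) 1} ≤
      ENNReal.ofReal (√(√(1 + 4 * (t * ρ - t ^ 2 * (1 - ρ ^ 2)))⁻¹ ^ d) ^ π.support.card) := by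
  have hs : √(1 - ρ ^ 2) ^ 2 = 1 - ρ ^ 2 := Real.sq_sqrt (by nlinarith [hρ.1, hρ.2])
  set a := t * ρ - t ^ 2 * (1 - ρ ^ 2) with ha_def
  set h : Fin n → EuclideanSpace ℝ (Fin d) := fun i => ((σ i : ℤ) : ℝ) • μ with hh
  set K : Fin n → EuclideanSpace ℝ (Fin d) × EuclideanSpace ℝ (Fin d) → ENNReal := fun i p =>
    ENNReal.ofReal (Real.exp (-a * ‖h i - h (π⁻¹ i) + p.1 - p.2‖ ^ 2 +
      2 * (t * (1 - ρ)) * inner ℝ (h i - h (π⁻¹ i)) p.2 -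
      t * (1 - ρ) * ‖h i - h (π⁻¹ i)‖ ^ 2)) with hK
  have hX : ∀ i, Measurable fun z : Database n d => rowsX μ σ z i := fun i => by
    unfold rowsX
    fun_prop
  set A : Database n d → ℝ := fun z => Real.exp (t * ∑ i,
    inner ℝ (rowsX μ σ z (π⁻¹ i) - rowsX μ σ z i) (((σ i : ℤ) : ℝ) • μ + ρ • z i)) with hA
  have hAm : Measurable A := by
    refine Real.measurable_exp.comp (Measurable.const_mul ?_ t)
    exact Finset.measurable_sum _ fun i _ =>
      ((hX (π⁻¹ i)).sub (hX i)).inner (by fun_prop)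
  set b : Fin n → Database n d → EuclideanSpace ℝ (Fin d) := fun i z =>
    (t * √(1 - ρ ^ 2)) • (rowsX μ σ z (π⁻¹ i) - rowsX μ σ z i) with hb
  have hbm : ∀ i, Measurable (b i) := fun i =>
    ((hX (π⁻¹ i)).sub (hX i)).const_smul (t * √(1 - ρ ^ 2))
  -- For fixed `z` this is a Gaussian moment generating function, namely the quadratic formula with
  -- `a = 0`; hence the artificial term `-0 * ‖w i‖ ^ 2` below.
  have hinner : ∀ z, ∫⁻ w, ENNReal.ofReal (A z * ∏ i, Real.exp (inner ℝ (b i z) (w i)))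
      ∂(gaussianRows n d) = ∏ i, K i (z i, z (π⁻¹ i)) ^ (1 / 2 : ℝ) := by
    intro z
    have e : ∀ w : Database n d, ENNReal.ofReal (A z * ∏ i, Real.exp (inner ℝ (b i z) (w i))) =
        ENNReal.ofReal (A z) * ∏ i, ENNReal.ofReal
          (Real.exp (-0 * ‖w i‖ ^ 2 + inner ℝ (b i z) (w i))) := by
      intro w
      rw [ENNReal.ofReal_mul (p := A z) (Real.exp_pos _).le,
        ENNReal.ofReal_prod_of_nonneg fun i _ => (Real.exp_pos _).le]
      simp only [neg_zero, zero_mul, zero_add]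
    rw [lintegral_congr e, lintegral_const_mul _ (by fun_prop), gaussianRows,
      lintegral_prod_pi (fun _ => stdGaussian (EuclideanSpace ℝ (Fin d)))
        (f := fun i y => ENNReal.ofReal (Real.exp (-0 * ‖y‖ ^ 2 + inner ℝ (b i z) y)))
        fun i => by fun_prop]
    simp_rw [lintegral_stdGaussian_exp_quadratic le_rfl]
    rw [← ENNReal.ofReal_prod_of_nonneg fun i _ => by positivity,
      ← ENNReal.ofReal_mul (Real.exp_pos _).le]
    simp only [hK]
    simp_rw [ENNReal.ofReal_rpow_of_pos (Real.exp_pos _), ← Real.exp_mul]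
    rw [← ENNReal.ofReal_prod_of_nonneg fun i _ => (Real.exp_pos _).le, ← Real.exp_sum]
    congr 1
    simp only [mul_zero, add_zero, inv_one, Real.sqrt_one, one_pow, one_mul, mul_one]
    rw [← Real.exp_sum, ← Real.exp_add]
    congr 1
    have := sum_inner_diff_eq π⁻¹ h z t ρ √(1 - ρ ^ 2)
    rw [hs] at this
    refine this.trans (Finset.sum_congr rfl fun i _ => ?_)
    rw [ha_def]
    ring
  have hKm : ∀ i, Measurable (K i) := fun i => by
    simp only [hK]
    fun_prop
  calc
    _ ≤ ∫⁻ p, ENNReal.ofReal (A p.1 * ∏ i, Real.exp (inner ℝ (b i p.1) (p.2 i)))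
          ∂((gaussianRows n d).prod (gaussianRows n d)) := by
        refine meas_le_lintegral₀ ?_ fun p hp => ?_
        · refine (ENNReal.measurable_ofReal.comp ((hAm.comp measurable_fst).mul
            (Finset.measurable_prod _ fun i _ => Real.measurable_exp.comp
              (((hbm i).comp measurable_fst).inner (by fun_prop))))).aemeasurable
        · rw [ENNReal.one_le_ofReal]
          exact one_le_exp_of_totalSqDist_le ht μ ρ σ p.1 p.2 π hp
    _ = ∫⁻ z, ∫⁻ w, ENNReal.ofReal (A z * ∏ i, Real.exp (inner ℝ (b i z) (w i)))
          ∂(gaussianRows n d) ∂(gaussianRows n d) := by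
        refine lintegral_prod _ ?_
        refine (ENNReal.measurable_ofReal.comp ((hAm.comp measurable_fst).mul
            (Finset.measurable_prod _ fun i _ => Real.measurable_exp.comp
              (((hbm i).comp measurable_fst).inner (by fun_prop))))).aemeasurable
    _ = ∫⁻ z, ∏ i, K i (z i, z (π⁻¹ i)) ^ (1 / 2 : ℝ) ∂(gaussianRows n d) :=
        lintegral_congr hinner
    _ ≤ ∏ i ∈ (π⁻¹).support, (∫⁻ p, K i p ∂((stdGaussian (EuclideanSpace ℝ (Fin d))).prod
          (stdGaussian (EuclideanSpace ℝ (Fin d))))) ^ (1 / 2 : ℝ) := by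
        -- At a fixed point both the means and the two arguments agree, so the kernel equals 1.
        refine lintegral_prod_sqrt_perm_le _ π⁻¹ hKm fun i hi y => ?_
        simp only [hK]
        rw [hi]
        simp
    _ ≤ ∏ i ∈ (π⁻¹).support, ENNReal.ofReal √(√(1 + 4 * a)⁻¹ ^ d) := by
        refine Finset.prod_le_prod' fun i _ => ?_
        rw [Real.sqrt_eq_rpow (√(1 + 4 * a)⁻¹ ^ d),
          ← ENNReal.ofReal_rpow_of_nonneg (by positivity) (by norm_num)]
        exact ENNReal.rpow_le_rpow (lintegral_pair_kernel_le ha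
          (mul_nonneg ht (by linarith [hρ.2])) hg _) (by norm_num)
    _ = _ := by
        rw [Finset.prod_const, Equiv.Perm.support_inv, ENNReal.ofReal_pow (by positivity)]

end CGMM

namespace CGMM

/-! ### The probability that some permutation beats the true one -/

theorem totalSqDist_permuteRows {n d : ℕ} (X Y : Database n d) (π₀ π : Equiv.Perm (Fin n)) :
    totalSqDist X (permuteRows π₀ Y) π = totalSqDist X Y (π₀⁻¹ * π) := rfl

/-- The event that the true permutation is not the unique minimizer of the total squared
distance. -/
def ambiguous (n d : ℕ) : Set (Equiv.Perm (Fin n) × Database n d × Database n d) :=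
  {s | ∃ π, π ≠ s.1 ∧ totalSqDist s.2.1 s.2.2 π ≤ totalSqDist s.2.1 s.2.2 s.1}

theorem measurableSet_ambiguous (n d : ℕ) : MeasurableSet (ambiguous n d) := by
  have h : ambiguous n d = ⋃ π₀ : Equiv.Perm (Fin n), ⋃ π : Equiv.Perm (Fin n), ⋃ _ : π ≠ π₀,
      ({π₀} : Set (Equiv.Perm (Fin n))) ×ˢ
        {p : Database n d × Database n d | totalSqDist p.1 p.2 π ≤ totalSqDist p.1 p.2 π₀} := by
    ext s
    simp [ambiguous]
  rw [h]
  refine .iUnion fun π₀ => .iUnion fun π => .iUnion fun _ => .prod trivial ?_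
  exact measurableSet_le (measurable_totalSqDist π) (measurable_totalSqDist π₀)

/-- Given the labels and `π₀`, the substitution `π ↦ π₀⁻¹ * π` reduces to `π₀ = 1` and the union
bound applies. The bound is uniform in both, so it survives averaging over any label law. -/
theorem law_ambiguous_le {n d : ℕ} (ν : Measure (Labels n)) [IsProbabilityMeasure ν]
    (μ : EuclideanSpace ℝ (Fin d)) (ρ : ℝ) {B : ENNReal}
    (hB : ∀ σ : Labels n, ∑ π ∈ Finset.univ.erase (1 : Equiv.Perm (Fin n)),
      (gaussianRows n d).prod (gaussianRows n d)
        {p | totalSqDist (rowsX μ σ p.1) (rowsY' μ ρ σ p.1 p.2) π ≤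
          totalSqDist (rowsX μ σ p.1) (rowsY' μ ρ σ p.1 p.2) 1} ≤ B) :
    law ν μ ρ (ambiguous n d) ≤ B := by
  have : IsProbabilityMeasure (uniformOn (Set.univ : Set (Equiv.Perm (Fin n)))) :=
    isProbabilityMeasure_uniformOn Set.finite_univ Set.univ_nonempty
  have hm := measurable_sample (n := n) μ ρ (measurableSet_ambiguous n d)
  rw [law, Measure.map_apply (measurable_sample μ ρ) (measurableSet_ambiguous n d), latentLaw,
    Measure.prod_apply hm]
  refine (lintegral_mono (g := fun _ => B) fun σ => ?_).trans_eq (by simp)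
  have hσ := measurable_prodMk_left (x := σ) hm
  rw [Measure.prod_apply hσ]
  refine (lintegral_mono (g := fun _ => B) fun π₀ => ?_).trans_eq (by simp)
  refine le_trans ?_ (hB σ)
  refine (measure_mono ?_).trans (measure_biUnion_finset_le _ _)
  rintro ⟨z, w⟩ ⟨π, hne, hle⟩
  simp only [totalSqDist_permuteRows, inv_mul_cancel] at hle
  simp only [Set.mem_iUnion]
  exact ⟨π₀⁻¹ * π, Finset.mem_erase.2 ⟨fun h => hne (inv_mul_eq_one.1 h).symm, Finset.mem_univ _⟩,
    hle⟩

theorem law_ambiguous_le_of_rate {n d : ℕ} {t ρ r : ℝ} (ht : 0 ≤ t) (hρ : ρ ∈ Set.Icc (0 : ℝ) 1)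
    (ha : 0 ≤ t * ρ - t ^ 2 * (1 - ρ ^ 2)) (hg : t * (1 - ρ) ≤ 1 / 2)
    (hr : n * √(√(1 + 4 * (t * ρ - t ^ 2 * (1 - ρ ^ 2)))⁻¹ ^ d) ≤ r) (hr' : r ≤ 1 / 2)
    (ν : Measure (Labels n)) [IsProbabilityMeasure ν] (μ : EuclideanSpace ℝ (Fin d)) :
    law ν μ ρ (ambiguous n d) ≤ ENNReal.ofReal (2 * r ^ 2) := by
  refine law_ambiguous_le ν μ ρ fun σ => ?_
  refine (Finset.sum_le_sum fun π _ =>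
    measure_totalSqDist_le_one_le ht hρ ha hg μ σ π).trans ?_
  rw [← ENNReal.ofReal_sum_of_nonneg fun i _ => by positivity]
  refine ENNReal.ofReal_le_ofReal ?_
  refine (sum_perm_pow_card_support_le (Real.sqrt_nonneg _) (hr.trans hr')).trans ?_
  gcongr

/-! ### Choice of the Chernoff parameter and the resulting rate -/

theorem sqrt_sqrt_inv_pow {x : ℝ} (hx : 0 < x) (d : ℕ) :
    √(√x⁻¹ ^ d) = Real.exp (-((d : ℝ) / 4 * Real.log x)) := by
  rw [Real.sqrt_eq_rpow, Real.sqrt_eq_rpow, ← Real.rpow_natCast, ← Real.rpow_mul (by positivity),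
    ← Real.rpow_mul (by positivity), Real.rpow_def_of_pos (by positivity), Real.log_inv]
  congr 1
  ring

theorem mul_exp_neg_le {n : ℕ} (hn : 0 < n) {a x : ℝ} (h : Real.log n + a ≤ x) :
    n * Real.exp (-x) ≤ Real.exp (-a) := by
  have hn' : (0 : ℝ) < n := by exact_mod_cast hn
  calc n * Real.exp (-x) = Real.exp (Real.log n + -x) := by rw [Real.exp_add, Real.exp_log hn']
    _ ≤ _ := Real.exp_le_exp.2 (by linarith)

/-- The Chernoff parameter can be chosen such that the bound is governed by `signal`. -/
theorem exists_chernoff_parameter {n d : ℕ} (hn : 0 < n) {ρ a : ℝ} (hρ : ρ ∈ Set.Icc (0 : ℝ) 1)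
    (ha : 0 < a) (h : ((Real.log n + a : ℝ) : EReal) ≤ signal d ρ) :
    ∃ t : ℝ, 0 ≤ t ∧ 0 ≤ t * ρ - t ^ 2 * (1 - ρ ^ 2) ∧ t * (1 - ρ) ≤ 1 / 2 ∧
      n * √(√(1 + 4 * (t * ρ - t ^ 2 * (1 - ρ ^ 2)))⁻¹ ^ d) ≤ Real.exp (-a) := by
  obtain ⟨h0, h1⟩ := hρ
  have hL : 0 < Real.log n + a := add_pos_of_nonneg_of_pos (Real.log_natCast_nonneg n) ha
  rcases h1.lt_or_eq with h1 | rfl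
  · have hs : 0 < 1 - ρ ^ 2 := by nlinarith
    rw [signal_of_lt_one d h0 h1, EReal.coe_le_coe_iff] at h
    have e : ρ / (2 * (1 - ρ ^ 2)) * ρ - (ρ / (2 * (1 - ρ ^ 2))) ^ 2 * (1 - ρ ^ 2) =
        ρ ^ 2 / (4 * (1 - ρ ^ 2)) := by
      field_simp
      ring
    have e' : 1 + 4 * (ρ ^ 2 / (4 * (1 - ρ ^ 2))) = 1 / (1 - ρ ^ 2) := by
      field_simp
      ring
    -- The maximizer of `tρ - t²(1 - ρ²)`; there `1 + 4a = 1 / (1 - ρ²)` and `t(1 - ρ) = ρ / (2(1 +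
    -- ρ))`.
    refine ⟨ρ / (2 * (1 - ρ ^ 2)), by positivity, ?_, ?_, ?_⟩
    · rw [e]
      positivity
    · rw [div_mul_eq_mul_div, div_le_div_iff₀ (by positivity) (by norm_num)]
      nlinarith
    · rw [e, e', sqrt_sqrt_inv_pow (by positivity)]
      exact mul_exp_neg_le hn h
  · have hd : d ≠ 0 := by
      rintro rfl
      rw [signal] at h
      simp only [Nat.cast_zero, zero_div, EReal.coe_zero, zero_mul] at h
      exact absurd (EReal.coe_nonpos.1 h) (not_le.2 hL)
    have hd' : (0 : ℝ) < d := by exact_mod_cast Nat.pos_of_ne_zero hd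
    -- At `ρ = 1` the quantity to maximize is `t` itself, which is unbounded; this `t` solves `(d/4)
    -- log (1 + 4t) = log n + a`.
    set t : ℝ := (Real.exp (4 * (Real.log n + a) / d) - 1) / 4 with ht
    have ht0 : 0 ≤ t := by
      have : 1 ≤ Real.exp (4 * (Real.log n + a) / d) := Real.one_le_exp (by positivity)
      exact div_nonneg (by linarith) (by norm_num)
    have e : t * 1 - t ^ 2 * (1 - 1 ^ 2) = t := by ring
    refine ⟨t, ht0, by rwa [e], by norm_num, ?_⟩
    rw [e, sqrt_sqrt_inv_pow (by positivity)]
    refine mul_exp_neg_le hn (le_of_eq ?_)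
    rw [ht, show 1 + 4 * ((Real.exp (4 * (Real.log n + a) / d) - 1) / 4) =
      Real.exp (4 * (Real.log n + a) / d) by ring, Real.log_exp]
    field_simp

/-! ### Passage to the limit -/

theorem tendsto_law_ambiguous {d : ℕ → ℕ} (μ : ∀ n, EuclideanSpace ℝ (Fin (d n))) {ρ : ℕ → ℝ}
    (hρ : ∀ n, ρ n ∈ Set.Icc (0 : ℝ) 1) (ν : ∀ n, Measure (Labels n))
    [∀ n, IsProbabilityMeasure (ν n)] {a : ℕ → ℝ} (ha : Tendsto a atTop atTop)
    (h : ∀ᶠ n : ℕ in atTop, ((Real.log n + a n : ℝ) : EReal) ≤ signal (d n) (ρ n)) :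
    Tendsto (fun n => law (ν n) (μ n) (ρ n) (ambiguous n (d n))) atTop (𝓝 0) := by
  have hexp : Tendsto (fun n => Real.exp (-a n)) atTop (𝓝 0) :=
    Real.tendsto_exp_neg_atTop_nhds_zero.comp ha
  have hlim : Tendsto (fun n => ENNReal.ofReal (2 * Real.exp (-a n) ^ 2)) atTop (𝓝 0) := by
    have := ENNReal.tendsto_ofReal ((hexp.pow 2).const_mul 2)
    simpa using this
  refine tendsto_of_tendsto_of_tendsto_of_le_of_le' tendsto_const_nhds hlim
    (Eventually.of_forall fun _ => zero_le) ?_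
  filter_upwards [h, ha.eventually_gt_atTop 0, eventually_gt_atTop 0,
    hexp.eventually_le_const (by norm_num : (0 : ℝ) < 1 / 2)] with n hn han hn0 hr
  obtain ⟨t, ht, hα, hγ, hq⟩ := exists_chernoff_parameter hn0 (hρ n) han hn
  exact law_ambiguous_le_of_rate ht (hρ n) hα hγ hq hr (ν n) (μ n)

theorem tendsto_law_success {d : ℕ → ℕ} (μ : ∀ n, EuclideanSpace ℝ (Fin (d n))) {ρ : ℕ → ℝ}
    (hρ : ∀ n, ρ n ∈ Set.Icc (0 : ℝ) 1) (ν : ∀ n, Measure (Labels n))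
    [∀ n, IsProbabilityMeasure (ν n)] {a : ℕ → ℝ} (ha : Tendsto a atTop atTop)
    (h : ∀ᶠ n : ℕ in atTop, ((Real.log n + a n : ℝ) : EReal) ≤ signal (d n) (ρ n))
    (πhat : ∀ n, Estimator n (d n)) (hmin : ∀ n, IsMinDistEstimator (πhat n)) :
    Tendsto (fun n => law (ν n) (μ n) (ρ n) {s | πhat n s.2 = s.1}) atTop (𝓝 1) := by
  have hlim : Tendsto (fun n => 1 - law (ν n) (μ n) (ρ n) (ambiguous n (d n))) atTop (𝓝 1) := by
    simpa using ENNReal.Tendsto.sub (tendsto_const_nhds (x := (1 : ENNReal)))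
      (tendsto_law_ambiguous μ hρ ν ha h) (Or.inl ENNReal.one_ne_top)
  refine tendsto_of_tendsto_of_tendsto_of_le_of_le hlim tendsto_const_nhds (fun n => ?_)
    fun n => prob_le_one
  simp only
  -- The success event need not be measurable for an arbitrary tie-breaking rule, but it contains
  -- the measurable event that the minimizer is unique and equal to the truth, and monotonicity
  -- suffices.
  rw [← prob_compl_eq_one_sub (measurableSet_ambiguous n (d n))]
  refine measure_mono fun s hs => ?_
  by_contra hne
  exact hs ⟨πhat n s.2, hne, hmin n s.2.1 s.2.2 s.1⟩

/-! ### A measurable minimum distance estimator -/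

theorem exists_measurable_isMinDistEstimator (n d : ℕ) :
    ∃ πhat : Estimator n d, Measurable πhat ∧ IsMinDistEstimator πhat := by
  classical
  obtain ⟨e⟩ : Nonempty (Equiv.Perm (Fin n) ≃ Fin (Fintype.card (Equiv.Perm (Fin n)))) :=
    ⟨Fintype.equivFin _⟩
  let M : Database n d × Database n d → Equiv.Perm (Fin n) → Prop := fun p π =>
    ∀ π', totalSqDist p.1 p.2 π ≤ totalSqDist p.1 p.2 π'
  have hM : ∀ p, ∃ k, M p (e.symm k) := by
    intro p
    obtain ⟨π, hπ⟩ := Finite.exists_min fun π => totalSqDist p.1 p.2 π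
    exact ⟨e π, by simpa [M] using hπ⟩
  have hMm : ∀ π, MeasurableSet {p | M p π} := fun π => by
    simp only [M, Set.ofPred_forall]
    exact .iInter fun π' => measurableSet_le (measurable_totalSqDist π) (measurable_totalSqDist π')
  -- Ties go to the first minimizer in a fixed enumeration, so each fibre is a finite intersection
  -- of measurable sets.
  refine ⟨fun p => e.symm (Fin.find (fun k => M p (e.symm k)) (hM p)), ?_, ?_⟩
  · refine measurable_to_countable' fun π => ?_
    have h : (fun p => e.symm (Fin.find (fun k => M p (e.symm k)) (hM p))) ⁻¹' {π} =
        {p | M p π} ∩ ⋂ k : Fin (Fintype.card (Equiv.Perm (Fin n))), ⋂ _ : k < e π,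
          {p | M p (e.symm k)}ᶜ := by
      ext p
      simp only [Set.mem_preimage, Set.mem_singleton_iff, Equiv.symm_apply_eq, Fin.find_eq_iff,
        Equiv.symm_apply_apply, Set.mem_inter_iff, Set.mem_ofPred_eq, Set.mem_iInter,
        Set.mem_compl_iff]
    rw [h]
    exact (hMm π).inter (.iInter fun k => .iInter fun _ => (hMm _).compl)
  · intro X Y π
    exact Fin.find_spec (hM (X, Y)) π

end CGMM
theorem theorem1
    (d : ℕ → ℕ) (μ : ∀ n, EuclideanSpace ℝ (Fin (d n))) (ρ : ℕ → ℝ)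
    (hρ : ∀ n, ρ n ∈ Set.Icc (0 : ℝ) 1)
    (ν : ∀ n, Measure (CGMM.Labels n)) (hν : ∀ n, IsProbabilityMeasure (ν n))
    (hcond :
      -- `(d/4) log (1/(1-ρ²)) ≥ log n + ω(1)` and `‖μ‖² ≥ 2 log n + ω(1)`
      ((∃ a : ℕ → ℝ, Tendsto a atTop atTop ∧
          ∀ᶠ n : ℕ in atTop, ((Real.log n + a n : ℝ) : EReal) ≤ CGMM.signal (d n) (ρ n)) ∧
        (∃ b : ℕ → ℝ, Tendsto b atTop atTop ∧
          ∀ᶠ n : ℕ in atTop, 2 * Real.log n + b n ≤ ‖μ n‖ ^ 2)) ∨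
      -- `(d/4) log (1/(1-ρ²)) ≥ (1+ε) log n` for a constant `ε > 0`, and `d = ω(log n)`
      ((∃ ε : ℝ, 0 < ε ∧
          ∀ᶠ n : ℕ in atTop, (((1 + ε) * Real.log n : ℝ) : EReal) ≤ CGMM.signal (d n) (ρ n)) ∧
        (fun n : ℕ => Real.log n) =o[atTop] (fun n : ℕ => (d n : ℝ)))) :
    (∃ πhat : ∀ n, CGMM.Estimator n (d n),
      (∀ n, Measurable (πhat n)) ∧ (∀ n, CGMM.IsMinDistEstimator (πhat n)) ∧
      Tendsto (fun n => CGMM.law (ν n) (μ n) (ρ n) {s | πhat n s.2 = s.1}) atTop (𝓝 1)) ∧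
    (∀ πhat : ∀ n, CGMM.Estimator n (d n), (∀ n, CGMM.IsMinDistEstimator (πhat n)) →
      Tendsto (fun n => CGMM.law (ν n) (μ n) (ρ n) {s | πhat n s.2 = s.1}) atTop (𝓝 1)) := by

  have key : ∃ a : ℕ → ℝ, Tendsto a atTop atTop ∧
      ∀ᶠ n : ℕ in atTop, ((Real.log n + a n : ℝ) : EReal) ≤ CGMM.signal (d n) (ρ n) := by
    rcases hcond with ⟨h, -⟩ | ⟨⟨ε, hε, h⟩, -⟩
    · exact h
    -- The surplus `ε log n` itself serves as the diverging sequence.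
    · refine ⟨fun n => ε * Real.log n,
        (Real.tendsto_log_atTop.comp tendsto_natCast_atTop_atTop).const_mul_atTop hε, ?_⟩
      filter_upwards [h] with n hn
      rwa [add_mul, one_mul] at hn
  obtain ⟨a, ha, h⟩ := key
  refine ⟨?_, CGMM.tendsto_law_success μ hρ ν ha h⟩
  choose πhat hmeas hmin using fun n => CGMM.exists_measurable_isMinDistEstimator n (d n)
  exact ⟨πhat, hmeas, hmin, CGMM.tendsto_law_success μ hρ ν ha h πhat hmin⟩
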